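/- Theorem 3 (Moments). For $i=1,2$ let $0<\omega_i<1$, $\lambda_i,a_i,b_i,c_i>0$, and let $I_1,I_2$ be independent random variables on a probability space, $I_i$ having the mixture Exponential–Generalized Gamma density $$f_{I_i}(x)=\frac{\omega_i}{\lambda_i}e^{-x/\lambda_i}+(1-\omega_i)\frac{c_i\,x^{a_ic_i-1}}{b_i^{a_ic_i}\Gamma(a_i)}e^{-(x/b_i)^{c_i}},\qquad x>0 .$$ Let $r_1,r_2\in\{1,2\}$, $\eta,N_{0_1},N_{0_2},C>0$, and put $$\gamma_i=\frac{(\eta I_i)^{r_i}}{N_{0_i}},\qquad \mu_{r_i}=\frac{\eta^{r_i}}{N_{0_i}},\qquad \gamma=\frac{\gamma_1\gamma_2}{\gamma_2+C}.$$ Then $\mu_{r_i}$ is the average electrical SNR of the $i$-th hop: if $r_i=1$ and $\mathbb E[I_i]=1$ (normalized fading) then $\mu_{r_i}=\mathbb E[\gamma_i]$, and if $r_i=2$ then $\mu_{r_i}=\mathbb E[\gamma_i]\big/\big(2\omega_i\lambda_i^2+b_i^2(1-\omega_i)\Gamma(a_i+2/c_i)/\Gamma(a_i)\big)$. Moreover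 $\gamma$ has a density $f_\gamma$, and for every integer $n\ge 1$ the moment $\mathbb E[\gamma^n]=\int_0^\infty x^n f_\gamma(x)\,dx$ is finite and $$\begin{aligned}\mathbb E[\gamma^n]={}&\left(\frac{\omega_1\omega_2}{\Gamma(n)}\Gamma(1+r_1n)(\lambda_1^{r_1}\mu_{r_1})^n+\frac{\omega_2(1-\omega_1)(b_1^{r_1}\mu_{r_1})^n}{\Gamma(a_1)\Gamma(n)}\Gamma\!\left(a_1+\frac{r_1n}{c_1}\right)\right)\mathrm H^{2,1}_{1,2}\!\left[\frac{C}{\lambda_2^{r_2}\mu_{r_2}}\,\middle|\,\begin{matrix}(1-n,1)\\(0,1),(1,r_2)\end{matrix}\right]\\&+\left(\frac{\omega_1(1-\omega_2)\Gamma(1+r_1n)(\lambda_1^{r_1}\mu_{r_1})^n}{\Gamma(a_2)\Gamma(n)}+\frac{(1-\omega_1)(1-\omega_2)(b_1^{r_1}\mu_{r_1})^n}{\Gamma(a_1)\Gamma(a_2)\Gamma(n)}\Gamma\!\left(a_1+\frac{r_1}{c_1}n\right)\right)\mathrm H^{2,1}_{1,2}\!\left[\frac{C}{b_2^{r_2}\mu_{r_2}}\,\middle|\,\begin{matrix}(1-n,1)\\(0,1),(a_2,\frac{r_2}{c_2})\end{matrix}\right].\end{aligned}$$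 Here Fox's H-function is the Mellin–Barnes integral $$\mathrm H^{m,k}_{p,q}\!\left[z\,\middle|\,\begin{matrix}(\alpha_1,A_1),\dots,(\alpha_p,A_p)\\(\beta_1,B_1),\dots,(\beta_q,B_q)\end{matrix}\right]=\frac1{2\pi i}\int_{\sigma-i\infty}^{\sigma+i\infty}\frac{\prod_{j\le m}\Gamma(\beta_j+B_js)\prod_{i\le k}\Gamma(1-\alpha_i-A_is)}{\prod_{j>m}\Gamma(1-\beta_j-B_js)\prod_{i>k}\Gamma(\alpha_i+A_is)}\,z^{-s}\,ds$$ along a vertical line separating the poles of the factors $\Gamma(\beta_j+B_js)$, $j\le m$, from those of the factors $\Gamma(1-\alpha_i-A_is)$, $i\le k$; for the two functions above such lines exist, and on each of them the integral converges absolutely, to a value that does not depend on the line. -/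

import Mathlib

open MeasureTheory ProbabilityTheory

/-! ### Fox's H-function of one variable -/

/-- The Mellin--Barnes kernel of `H^{m,n}_{p,q}` with upper parameters `(a i).1, (a i).2` and lower
parameters `(b j).1, (b j).2`:
`∏_{j ≤ m} Γ(b_j + B_j s) ∏_{i ≤ n} Γ(1 - a_i - A_i s)` divided by
`∏_{j > m} Γ(1 - b_j - B_j s) ∏_{i > n} Γ(a_i + A_i s)`.
Indices in `Fin` start at `0`, so "the first `m`" reads `j < m`. -/
noncomputable def foxHKernel {p q : ℕ} (m n : ℕ) (a : Fin p → ℂ × ℝ) (b : Fin q → ℂ × ℝ)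
    (s : ℂ) : ℂ :=
  (∏ j : Fin q, if (j : ℕ) < m then Complex.Gamma ((b j).1 + (b j).2 * s) else 1) *
    (∏ i : Fin p, if (i : ℕ) < n then Complex.Gamma (1 - (a i).1 - (a i).2 * s) else 1) /
  ((∏ j : Fin q, if (j : ℕ) < m then 1 else Complex.Gamma (1 - (b j).1 - (b j).2 * s)) *
    (∏ i : Fin p, if (i : ℕ) < n then 1 else Complex.Gamma ((a i).1 + (a i).2 * s)))

/-- The vertical line `Re s = σ` separates the poles `s = -(b_j + k) / B_j` of the factors
`Γ(b_j + B_j s)`, `j ≤ m` (to its left), from the poles `s = (1 - a_i + k) / A_i` of the factors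
`Γ(1 - a_i - A_i s)`, `i ≤ n` (to its right). -/
def FoxHSeparates {p q : ℕ} (m n : ℕ) (a : Fin p → ℂ × ℝ) (b : Fin q → ℂ × ℝ) (σ : ℝ) : Prop :=
  (∀ j : Fin q, (j : ℕ) < m → ∀ k : ℕ, (-((b j).1 + k) / ((b j).2 : ℂ)).re < σ) ∧
  (∀ i : Fin p, (i : ℕ) < n → ∀ k : ℕ, σ < ((1 - (a i).1 + k) / ((a i).2 : ℂ)).re)

/-- The Mellin--Barnes integrand at the point `σ + i t`. -/
noncomputable def foxHIntegrand {p q : ℕ} (m n : ℕ) (a : Fin p → ℂ × ℝ) (b : Fin q → ℂ × ℝ)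
    (z : ℂ) (σ t : ℝ) : ℂ :=
  z ^ (-((σ : ℂ) + t * Complex.I)) * foxHKernel m n a b ((σ : ℂ) + t * Complex.I)

/-- `(1 / 2πi) ∫_{σ - i∞}^{σ + i∞}` of the Mellin--Barnes integrand, parametrized by
`s = σ + i t`, `ds = i dt`. -/
noncomputable def foxHLine {p q : ℕ} (m n : ℕ) (a : Fin p → ℂ × ℝ) (b : Fin q → ℂ × ℝ)
    (z : ℂ) (σ : ℝ) : ℂ :=
  (1 / (2 * Real.pi) : ℂ) * ∫ t : ℝ, foxHIntegrand m n a b z σ t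

open Classical in
/-- Fox's H-function `H^{m,n}_{p,q}[z | a; b]` as a Mellin--Barnes integral along a vertical line
that separates the two families of poles (value `0` if there is no such line). -/
noncomputable def foxH {p q : ℕ} (m n : ℕ) (a : Fin p → ℂ × ℝ) (b : Fin q → ℂ × ℝ) (z : ℂ) : ℂ :=
  if h : ∃ σ : ℝ, FoxHSeparates m n a b σ then foxHLine m n a b z h.choose else 0

/-- `H^{m,n}_{p,q}[z | a; b]` is well defined: there is a separating vertical line, and on every
such line the Mellin--Barnes integral converges absolutely, to the same value. -/
def FoxHWellDefined {p q : ℕ} (m n : ℕ) (a : Fin p → ℂ × ℝ) (b : Fin q → ℂ × ℝ) (z : ℂ) : Prop :=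
  (∃ σ : ℝ, FoxHSeparates m n a b σ) ∧
  ∀ σ : ℝ, FoxHSeparates m n a b σ →
    Integrable (foxHIntegrand m n a b z σ) ∧ foxHLine m n a b z σ = foxH m n a b z

/-! ### The mixture Exponential-Generalized Gamma (EGG) distribution -/

/-- Parameters of the mixture EGG distribution: the weight `w`, the parameter `lam` of the
exponential component, and the parameters `a, b, c` of the generalized Gamma component. -/
structure EGGParams where
  w : ℝ
  lam : ℝ
  a : ℝ
  b : ℝ
  c : ℝ
  w_pos : 0 < w
  w_lt_one : w < 1
  lam_pos : 0 < lam
  a_pos : 0 < a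
  b_pos : 0 < b
  c_pos : 0 < c

/-- The density of the mixture EGG distribution, supported on `(0, ∞)`. -/
noncomputable def eggPDF (p : EGGParams) (x : ℝ) : ℝ :=
  if 0 < x then
    p.w / p.lam * Real.exp (-(x / p.lam)) +
      (1 - p.w) * (p.c * x ^ (p.a * p.c - 1) / (p.b ^ (p.a * p.c) * Real.Gamma p.a)) *
        Real.exp (-((x / p.b) ^ p.c))
  else 0

/-- The mixture EGG distribution. -/
noncomputable def eggMeasure (p : EGGParams) : Measure ℝ :=
  volume.withDensity fun x => ENNReal.ofReal (eggPDF p x)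

/-! ### The dual-hop system -/

/-- Instantaneous SNR `(η I)^r / N₀` of a hop with irradiance `I`. -/
noncomputable def hopSNR (η N₀ : ℝ) (r : ℕ) (I : ℝ) : ℝ := (η * I) ^ r / N₀

/-- Electrical SNR `μ_r = η^r / N₀` of a hop (the SNR at unit irradiance). -/
noncomputable def electricalSNR (η N₀ : ℝ) (r : ℕ) : ℝ := η ^ r / N₀

/-- End-to-end SNR of a fixed gain relay with relay constant `C`. -/
noncomputable def endToEndSNR (C g₁ g₂ : ℝ) : ℝ := g₁ * g₂ / (g₂ + C)

/-- `μ` is the average electrical SNR expressed through the average SNR `gbar = E[γ_i]` of a hop and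
the mean irradiance `Ibar`: for `r = 2`, `μ = gbar / (2 ω λ² + (1 - ω) b² Γ(a + 2/c) / Γ(a))`; for
`r = 1` and normalized fading (`Ibar = 1`), `μ = gbar`. -/
def IsAverageElectricalSNR (p : EGGParams) (r : ℕ) (Ibar gbar μ : ℝ) : Prop :=
  (r = 1 → Ibar = 1 → μ = gbar) ∧
  (r = 2 → μ = gbar / (2 * p.w * p.lam ^ 2 +
    p.b ^ 2 * (1 - p.w) * Real.Gamma (p.a + 2 / p.c) / Real.Gamma p.a))

/-! The SNR factors: `γ ^ n = (μ₁ ^ n * I₁ ^ (r₁ * n)) * g (I₂) ^ n`, where `g y = μ₂ y ^ r₂ / (μ₂ y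
^ r₂ + C)` lies in `(0, 1)` for `y > 0`. Independence splits the mean. The exponential law is the
generalized Gamma law with `a = c = 1`, and a generalized Gamma variable is `b G ^ (1 / c)` with `G`
standard Gamma, so the first factor is a sum of two Gamma values.

For the second factor, `g (b x ^ (1 / c)) ^ n = (1 + z x ^ (-B)) ^ (-n)` with `z = C / (b ^ r₂ μ₂)`
and `B = r₂ / c`. Its Gamma mean is an H-function: the Cahen–Mellin integral represents `exp (-z)`
with kernel `Γ(s)`, and integration against a Gamma density multiplies the kernel by a Gamma factor
(`mellinBarnes_gammaFactor`). Used twice, this produces `Γ(n - s)` and `Γ(a + B s)`, on every line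
`0 < Re s < n`, with a value free of the line (`foxH_wellDefined_and_eq`).

The density exists because, for fixed `I₂ > 0`, `γ` is a positive multiple of a power of `I₁`, and
such maps pull null sets back to null sets on `(0, ∞)`. -/

/-! ### The Gamma function on vertical lines. -/

theorem Complex.norm_Gamma_le_Gamma_re {s : ℂ} (hs : 0 < s.re) :
    ‖Complex.Gamma s‖ ≤ Real.Gamma s.re := by
  rw [Complex.Gamma_eq_integral hs, Real.Gamma_eq_integral hs, Complex.GammaIntegral]
  refine (norm_integral_le_integral_norm _).trans_eq ?_
  refine setIntegral_congr_fun measurableSet_Ioi fun x hx => ?_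
  simp only [norm_mul, Complex.norm_cpow_eq_rpow_re_of_pos hx, Complex.sub_re, Complex.one_re]
  rw [Complex.norm_of_nonneg (Real.exp_pos _).le]

theorem continuous_Gamma_vertical {a β σ : ℝ} (h : 0 < a + β * σ) :
    Continuous fun t : ℝ => Complex.Gamma (a + β * (σ + t * Complex.I)) := by
  refine continuous_iff_continuousAt.2 fun t => ?_
  have h1 : ContinuousAt Complex.Gamma (a + β * (σ + t * Complex.I)) := by
    refine (Complex.differentiableAt_Gamma _ fun m hm => ?_).continuousAt
    have := congrArg Complex.re hm
    simp at this
    have : (0:ℝ) ≤ m := m.cast_nonneg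
    linarith
  exact h1.comp (f := fun t : ℝ => (a + β * (σ + t * Complex.I) : ℂ))
    (by fun_prop : Continuous _).continuousAt

/-- Since `Γ(s + 2) = (s + 1) s Γ(s)` and `Γ(s + 2)` is bounded on the line, `Γ(s)` decays at least
like `|s|⁻²`, which a rescaled Cauchy density dominates. -/
theorem integrable_Gamma_vertical {σ : ℝ} (hσ : 0 < σ) :
    Integrable fun t : ℝ => Complex.Gamma (σ + t * Complex.I) := by
  have hcont : Continuous fun t : ℝ => Complex.Gamma (σ + t * Complex.I) := by
    simpa using continuous_Gamma_vertical (a := 0) (β := 1) (σ := σ) (by simpa)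
  have hint : Integrable fun t : ℝ =>
      Real.Gamma (σ + 2) * ((σ ^ 2)⁻¹ * (1 + (σ⁻¹ * t) ^ 2)⁻¹) :=
    ((integrable_inv_one_add_sq.comp_mul_left' (inv_ne_zero hσ.ne')).const_mul _).const_mul _
  refine hint.mono' hcont.aestronglyMeasurable (Filter.Eventually.of_forall fun t => ?_)
  set s : ℂ := σ + t * Complex.I with hs
  have hre : s.re = σ := by simp [hs]
  have him : s.im = t := by simp [hs]
  have hs0 : s ≠ 0 := fun h => hσ.ne' (by rw [← hre, h, Complex.zero_re])
  have hs1 : s + 1 ≠ 0 := fun h => by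
    have := congrArg Complex.re h
    simp [hre] at this
    linarith
  have hrec : Complex.Gamma (s + 2) = (s + 1) * s * Complex.Gamma s := by
    rw [show s + 2 = s + 1 + 1 by ring, Complex.Gamma_add_one _ hs1, Complex.Gamma_add_one _ hs0]
    ring
  have hle : ‖Complex.Gamma (s + 2)‖ ≤ Real.Gamma (σ + 2) := by
    have := Complex.norm_Gamma_le_Gamma_re (s := s + 2) (by simp [hre]; linarith)
    simpa [hre] using this
  have hsq : ‖s‖ ^ 2 = σ ^ 2 + t ^ 2 := by
    rw [Complex.sq_norm, Complex.normSq_apply, hre, him]; ring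
  have hsn : ‖s‖ ≤ ‖s + 1‖ := by
    refine le_of_sq_le_sq ?_ (norm_nonneg _)
    rw [hsq, Complex.sq_norm, Complex.normSq_apply]
    simp only [Complex.add_re, Complex.add_im, hre, him, Complex.one_re, Complex.one_im]
    nlinarith
  have hden : σ ^ 2 * (1 + (σ⁻¹ * t) ^ 2) = ‖s‖ ^ 2 := by
    rw [hsq]; field_simp
  rw [← mul_inv, hden, ← div_eq_mul_inv, le_div_iff₀ (by positivity)]
  calc ‖Complex.Gamma s‖ * ‖s‖ ^ 2 ≤ ‖Complex.Gamma s‖ * (‖s + 1‖ * ‖s‖) := by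
        rw [sq]; gcongr
    _ = ‖Complex.Gamma (s + 2)‖ := by rw [hrec, norm_mul, norm_mul]; ring
    _ ≤ _ := hle

/-! ### Mellin–Barnes integrals of products of Gamma functions. -/

/-- The Cahen--Mellin integral. -/
theorem integral_cpow_mul_Gamma_vertical {σ x : ℝ} (hσ : 0 < σ) (hx : 0 < x) :
    ∫ t : ℝ, (x : ℂ) ^ (-(σ + t * Complex.I)) * Complex.Gamma (σ + t * Complex.I) =
      2 * Real.pi * Real.exp (-x) := by
  have hG : ∀ s : ℂ, 0 < s.re → mellin (fun x : ℝ => (Real.exp (-x) : ℂ)) s = Complex.Gamma s :=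
    fun s hs => by rw [Complex.Gamma_eq_integral hs, Complex.GammaIntegral_eq_mellin]
  have hGt : ∀ t : ℝ, mellin (fun x : ℝ => (Real.exp (-x) : ℂ)) (σ + t * Complex.I) =
      Complex.Gamma (σ + t * Complex.I) := fun t => hG _ (by simpa)
  have hconv : MellinConvergent (fun x : ℝ => (Real.exp (-x) : ℂ)) σ := by
    have := Complex.GammaIntegral_convergent (s := σ) (by simpa)
    refine this.congr_fun (fun x _ => ?_) measurableSet_Ioi
    simp [mul_comm]
  have h := mellinInv_mellin_eq σ (fun x : ℝ => (Real.exp (-x) : ℂ)) hx hconv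
    ((integrable_Gamma_vertical hσ).congr (Filter.Eventually.of_forall fun t => (hGt t).symm))
    (by fun_prop)
  simp only [mellinInv, hGt, smul_eq_mul, Complex.real_smul] at h
  rw [← h]
  push_cast
  rw [← mul_assoc, mul_one_div_cancel (by simp), one_mul]

/-- Integrating an inverse Mellin transform against a Gamma density multiplies its kernel by a
Gamma factor. -/
theorem mellinBarnes_gammaFactor {K : ℝ → ℂ} (hK : Integrable K) {φ : ℝ → ℂ} {σ a β : ℝ}
    (hσ : 0 < a + β * σ)
    (hφ : ∀ x : ℝ, 0 < x → ∫ t : ℝ, (x : ℂ) ^ (-(σ + t * Complex.I)) * K t = φ x) :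
    Integrable (fun t : ℝ => K t * Complex.Gamma (a + β * (σ + t * Complex.I))) ∧
    ∀ z : ℝ, 0 < z → ∫ t : ℝ, (z : ℂ) ^ (-(σ + t * Complex.I)) *
        (K t * Complex.Gamma (a + β * (σ + t * Complex.I))) =
      ∫ x in Set.Ioi (0 : ℝ), ((x ^ (a - 1) * Real.exp (-x) : ℝ) : ℂ) * φ (z * x ^ (-β)) := by
  constructor
  · refine hK.mul_bdd (c := Real.Gamma (a + β * σ))
      (continuous_Gamma_vertical hσ).aestronglyMeasurable (Filter.Eventually.of_forall fun t => ?_)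
    have := Complex.norm_Gamma_le_Gamma_re (s := a + β * (σ + t * Complex.I)) (by simpa)
    simpa using this
  intro z hz
  have hmeas : AEStronglyMeasurable
      (Function.uncurry fun (x : ℝ) (t : ℝ) => ((x ^ (a - 1) * Real.exp (-x) : ℝ) : ℂ) *
        (((z * x ^ (-β) : ℝ) : ℂ) ^ (-(σ + t * Complex.I)) * K t))
      ((volume.restrict (Set.Ioi 0)).prod volume) := by
    have h1 : AEStronglyMeasurable (fun p : ℝ × ℝ => K p.2)
        ((volume.restrict (Set.Ioi 0)).prod volume) := hK.aestronglyMeasurable.comp_snd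
    have h2 : Measurable fun p : ℝ × ℝ => ((p.1 ^ (a - 1) * Real.exp (-p.1) : ℝ) : ℂ) := by
      fun_prop
    have h3 : Measurable fun p : ℝ × ℝ =>
        ((z * p.1 ^ (-β) : ℝ) : ℂ) ^ (-((σ : ℂ) + p.2 * Complex.I)) := by
      apply Measurable.pow <;> fun_prop
    exact h2.aestronglyMeasurable.mul (h3.aestronglyMeasurable.mul h1)
  -- On the line, the norm of `(z x ^ (-β)) ^ (-s)` is `z ^ (-σ) x ^ (β σ)`, independent of `t`; the
  -- norm of the integrand is thus a product of a Gamma integrand in `x` and `‖K t‖`, and Fubini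
  -- applies.
  have hint : Integrable
      (Function.uncurry fun (x : ℝ) (t : ℝ) => ((x ^ (a - 1) * Real.exp (-x) : ℝ) : ℂ) *
        (((z * x ^ (-β) : ℝ) : ℂ) ^ (-(σ + t * Complex.I)) * K t))
      ((volume.restrict (Set.Ioi 0)).prod volume) := by
    have hb := (Real.GammaIntegral_convergent hσ).const_mul (z ^ (-σ))
    refine (hb.mul_prod hK.norm).mono' hmeas ?_
    have : ∀ᵐ p : ℝ × ℝ ∂(volume.restrict (Set.Ioi 0)).prod volume, 0 < p.1 :=
      Measure.quasiMeasurePreserving_fst.ae (ae_restrict_mem measurableSet_Ioi)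
    filter_upwards [this] with p hp
    have hp' : 0 < z * p.1 ^ (-β) := by positivity
    simp only [Function.uncurry, norm_mul, Complex.norm_real,
      Complex.norm_cpow_eq_rpow_re_of_pos hp']
    rw [Real.norm_of_nonneg (by positivity), Real.norm_of_nonneg (by positivity)]
    simp only [Complex.neg_re, Complex.add_re, Complex.ofReal_re, Complex.mul_re, Complex.I_re,
      mul_zero, Complex.ofReal_im, Complex.I_im, mul_one, sub_self, add_zero]
    rw [Real.mul_rpow hz.le (by positivity), ← Real.rpow_mul hp.le,
      show a + β * σ - 1 = (a - 1) + -β * -σ by ring, Real.rpow_add hp]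
    exact le_of_eq (by ring)
  have hswap := integral_integral_swap hint
  rw [show (∫ x in Set.Ioi (0 : ℝ), ((x ^ (a - 1) * Real.exp (-x) : ℝ) : ℂ) * φ (z * x ^ (-β))) =
      ∫ x in Set.Ioi (0 : ℝ), ∫ t : ℝ, ((x ^ (a - 1) * Real.exp (-x) : ℝ) : ℂ) *
        (((z * x ^ (-β) : ℝ) : ℂ) ^ (-(σ + t * Complex.I)) * K t) from
    setIntegral_congr_fun measurableSet_Ioi fun x (hx : 0 < x) => by
      simp only [integral_const_mul]
      rw [hφ _ (by positivity)], hswap]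
  refine integral_congr_ae (Filter.Eventually.of_forall fun t => ?_)
  simp only
  rw [Complex.Gamma_eq_integral (by simpa), Complex.GammaIntegral, ← integral_const_mul,
    ← integral_const_mul]
  refine setIntegral_congr_fun measurableSet_Ioi fun x (hx : 0 < x) => ?_
  have hxc : (x : ℂ) ≠ 0 := by exact_mod_cast hx.ne'
  have h1 : ((x ^ (-β) : ℝ) : ℂ) ^ (-((σ : ℂ) + t * Complex.I)) =
      (x : ℂ) ^ ((β : ℂ) * ((σ : ℂ) + t * Complex.I)) := by
    rw [← Complex.cpow_mul_ofReal_nonneg hx.le]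
    congr 1
    push_cast
    ring
  rw [Complex.ofReal_mul z, Complex.mul_cpow_ofReal_nonneg hz.le (by positivity), h1,
    Complex.ofReal_mul, Complex.ofReal_cpow hx.le (a - 1),
    show ((a : ℂ) + β * (σ + t * Complex.I) - 1) =
      ((a - 1 : ℝ) : ℂ) + β * (σ + t * Complex.I) by push_cast; ring,
    Complex.cpow_add _ _ hxc]
  ring

/-- The Mellin--Barnes integral with kernel `Γ(s) Γ(ν - s) Γ(a + B s)`. -/
theorem integral_cpow_mul_Gamma_mul_Gamma_mul_Gamma {σ ν a B : ℝ} (hσ : 0 < σ) (hν : σ < ν)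
    (ha : 0 < a) (hB : 0 < B) :
    Integrable (fun t : ℝ => Complex.Gamma (σ + t * Complex.I) *
      Complex.Gamma (ν - (σ + t * Complex.I)) * Complex.Gamma (a + B * (σ + t * Complex.I))) ∧
    ∀ z : ℝ, 0 < z → ∫ t : ℝ, (z : ℂ) ^ (-(σ + t * Complex.I)) *
        (Complex.Gamma (σ + t * Complex.I) * Complex.Gamma (ν - (σ + t * Complex.I)) *
          Complex.Gamma (a + B * (σ + t * Complex.I))) =
      ((2 * Real.pi * (Real.Gamma ν * ∫ x in Set.Ioi (0 : ℝ),
        x ^ (a - 1) * Real.exp (-x) * (1 + z * x ^ (-B)) ^ (-ν)) : ℝ) : ℂ) := by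
  -- The choice `a = ν`, `β = -1` creates the factor `Γ(ν - s)`.
  obtain ⟨h1, h2⟩ := mellinBarnes_gammaFactor (integrable_Gamma_vertical hσ)
    (a := ν) (β := -1) (σ := σ) (by linarith)
    (fun x hx => integral_cpow_mul_Gamma_vertical hσ hx)
  have hsub : ∀ t : ℝ, (ν : ℂ) + ((-1 : ℝ) : ℂ) * (σ + t * Complex.I) =
      ν - (σ + t * Complex.I) := fun t => by push_cast; ring
  simp only [hsub] at h1 h2
  obtain ⟨h3, h4⟩ := mellinBarnes_gammaFactor h1 (a := a) (β := B) (σ := σ) (by positivity)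
    (fun x hx => h2 x hx)
  refine ⟨h3, fun z hz => ?_⟩
  rw [h4 z hz, ← mul_assoc, ← integral_const_mul, ← integral_complex_ofReal]
  refine setIntegral_congr_fun measurableSet_Ioi fun x (hx : 0 < x) => ?_
  have hu : 0 < 1 + z * x ^ (-B) := by positivity
  -- The two exponentials merge into one of rate `1 + z x ^ (-B)`, leaving an Euler integral.
  have hin : ∫ y in Set.Ioi (0 : ℝ), ((y ^ (ν - 1) * Real.exp (-y) : ℝ) : ℂ) *
      (2 * Real.pi * Real.exp (-(z * x ^ (-B) * y ^ (-(-1 : ℝ))))) =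
      ((2 * Real.pi * ((1 + z * x ^ (-B)) ^ (-ν) * Real.Gamma ν) : ℝ) : ℂ) := by
    have hI := Real.integral_rpow_mul_exp_neg_mul_Ioi (hσ.trans hν) hu
    rw [one_div, Real.inv_rpow hu.le, ← Real.rpow_neg hu.le] at hI
    rw [← hI, Complex.ofReal_mul, ← integral_complex_ofReal, ← integral_const_mul]
    refine setIntegral_congr_fun measurableSet_Ioi fun y (hy : 0 < y) => ?_
    rw [show -((1 + z * x ^ (-B)) * y) = -y + -(z * x ^ (-B) * y) by ring, Real.exp_add]
    simp only [neg_neg, Real.rpow_one]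
    push_cast
    ring
  rw [hin]
  simp only [Complex.ofReal_mul]
  ring

/-! ### The two H-functions as real integrals. -/

/-- The poles nearest the strip are `0`, from `Γ(s)`, and `n`, from `Γ(n - s)`. Those of `Γ(a + B
s)` are negative and add no constraint. -/
theorem foxHSeparates_iff {n : ℕ} {a B σ : ℝ} (ha : 0 < a) (hB : 0 < B) :
    FoxHSeparates 2 1 ![((1 - n : ℂ), (1 : ℝ))] ![((0 : ℂ), (1 : ℝ)), ((a : ℂ), B)] σ ↔
      0 < σ ∧ σ < n := by
  have hdiv : ∀ k : ℕ, (-((a : ℂ) + k) / (B : ℂ)).re = -(a + k) / B := fun k => by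
    rw [show (-((a : ℂ) + k) / (B : ℂ)) = ((-(a + k) / B : ℝ) : ℂ) by push_cast; rfl,
      Complex.ofReal_re]
  simp only [FoxHSeparates, Fin.forall_fin_two, Fin.forall_fin_one]
  constructor
  · rintro ⟨⟨h1, -⟩, h2⟩
    exact ⟨by simpa using h1 (by simp) 0, by simpa using h2 (by simp) 0⟩
  · rintro ⟨h1, h2⟩
    refine ⟨⟨fun _ k => ?_, fun _ k => ?_⟩, fun _ k => ?_⟩
    · simp
      linarith [(k.cast_nonneg : (0 : ℝ) ≤ k)]
    · simp only [Matrix.cons_val_one, Matrix.cons_val_fin_one, hdiv]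
      refine lt_of_le_of_lt ?_ h1
      exact div_nonpos_of_nonpos_of_nonneg (by linarith [(k.cast_nonneg : (0 : ℝ) ≤ k)]) hB.le
    · simp
      linarith [(k.cast_nonneg : (0 : ℝ) ≤ k)]

theorem foxHIntegrand_eq {n : ℕ} {a B z : ℝ} (σ t : ℝ) :
    foxHIntegrand 2 1 ![((1 - n : ℂ), (1 : ℝ))] ![((0 : ℂ), (1 : ℝ)), ((a : ℂ), B)] z σ t =
      (z : ℂ) ^ (-((σ : ℂ) + t * Complex.I)) *
        (Complex.Gamma (σ + t * Complex.I) * Complex.Gamma ((n : ℝ) - (σ + t * Complex.I)) *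
          Complex.Gamma (a + B * (σ + t * Complex.I))) := by
  simp [foxHIntegrand, foxHKernel, Fin.prod_univ_two]
  left
  ring

theorem foxH_wellDefined_and_eq {n : ℕ} (hn : 1 ≤ n) {a B z : ℝ} (ha : 0 < a) (hB : 0 < B)
    (hz : 0 < z) :
    FoxHWellDefined 2 1 ![((1 - n : ℂ), (1 : ℝ))] ![((0 : ℂ), (1 : ℝ)), ((a : ℂ), B)] z ∧
    foxH 2 1 ![((1 - n : ℂ), (1 : ℝ))] ![((0 : ℂ), (1 : ℝ)), ((a : ℂ), B)] z =
      ((Real.Gamma n * ∫ x in Set.Ioi (0 : ℝ),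
        x ^ (a - 1) * Real.exp (-x) * (1 + z * x ^ (-B)) ^ (-(n : ℝ)) : ℝ) : ℂ) := by
  have hn' : (1 : ℝ) ≤ n := by exact_mod_cast hn
  have hex : ∃ σ : ℝ, FoxHSeparates 2 1 ![((1 - n : ℂ), (1 : ℝ))]
      ![((0 : ℂ), (1 : ℝ)), ((a : ℂ), B)] σ :=
    ⟨1 / 2, (foxHSeparates_iff ha hB).2 ⟨by norm_num, by linarith⟩⟩
  have hline : ∀ σ : ℝ, FoxHSeparates 2 1 ![((1 - n : ℂ), (1 : ℝ))]
      ![((0 : ℂ), (1 : ℝ)), ((a : ℂ), B)] σ →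
      foxHLine 2 1 ![((1 - n : ℂ), (1 : ℝ))] ![((0 : ℂ), (1 : ℝ)), ((a : ℂ), B)] z σ =
      ((Real.Gamma n * ∫ x in Set.Ioi (0 : ℝ),
        x ^ (a - 1) * Real.exp (-x) * (1 + z * x ^ (-B)) ^ (-(n : ℝ)) : ℝ) : ℂ) := by
    intro σ hσ
    obtain ⟨h0, h1⟩ := (foxHSeparates_iff ha hB).1 hσ
    simp only [foxHLine, foxHIntegrand_eq]
    rw [(integral_cpow_mul_Gamma_mul_Gamma_mul_Gamma h0 h1 ha hB).2 z hz, Complex.ofReal_mul]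
    push_cast
    rw [← mul_assoc, one_div_mul_cancel (by simp), one_mul]
  have heq : foxH 2 1 ![((1 - n : ℂ), (1 : ℝ))] ![((0 : ℂ), (1 : ℝ)), ((a : ℂ), B)] z =
      ((Real.Gamma n * ∫ x in Set.Ioi (0 : ℝ),
        x ^ (a - 1) * Real.exp (-x) * (1 + z * x ^ (-B)) ^ (-(n : ℝ)) : ℝ) : ℂ) := by
    rw [foxH, dif_pos hex, hline _ hex.choose_spec]
  refine ⟨⟨hex, fun σ hσ => ⟨?_, by rw [hline σ hσ, heq]⟩⟩, heq⟩
  obtain ⟨h0, h1⟩ := (foxHSeparates_iff ha hB).1 hσ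
  refine Integrable.congr ?_ (Filter.Eventually.of_forall fun t => (foxHIntegrand_eq σ t).symm)
  refine (integral_cpow_mul_Gamma_mul_Gamma_mul_Gamma h0 h1 ha hB).1.bdd_mul (c := z ^ (-σ))
    ?_ (Filter.Eventually.of_forall fun t => ?_)
  · refine Measurable.aestronglyMeasurable ?_
    apply Measurable.pow <;> fun_prop
  · rw [Complex.norm_cpow_eq_rpow_re_of_pos hz]
    simp

/-! ### Means under the generalized Gamma and mixture laws. -/

/-- The density of the generalized Gamma distribution on `(0, ∞)`. -/
noncomputable def genGammaPDF (a b c x : ℝ) : ℝ :=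
  c * x ^ (a * c - 1) / (b ^ (a * c) * Real.Gamma a) * Real.exp (-((x / b) ^ c))

/-- The mean of `h (b G ^ (1 / c))` where `G` has the standard Gamma distribution of shape `a`. -/
noncomputable def genGammaMean (a b c : ℝ) (h : ℝ → ℝ) : ℝ :=
  (Real.Gamma a)⁻¹ * ∫ x in Set.Ioi (0 : ℝ), x ^ (a - 1) * Real.exp (-x) * h (b * x ^ (1 / c))

/-- Substitution `u = (x / b) ^ c`, carried out as a power change of variable followed by a scaling.
-/
theorem integral_genGammaPDF_mul {a b c : ℝ} (hb : 0 < b) (hc : 0 < c)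
    {h : ℝ → ℝ} (hint : IntegrableOn
      (fun x => x ^ (a - 1) * Real.exp (-x) * h (b * x ^ (1 / c))) (Set.Ioi 0)) :
    IntegrableOn (fun x => genGammaPDF a b c x * h x) (Set.Ioi 0) ∧
    ∫ x in Set.Ioi (0 : ℝ), genGammaPDF a b c x * h x = genGammaMean a b c h := by
  set F : ℝ → ℝ := fun x => x ^ (a - 1) * Real.exp (-x) * h (b * x ^ (1 / c)) with hF
  set G : ℝ → ℝ := fun u => (c * u ^ (c - 1)) • F (u ^ c) with hG
  have heq : Set.EqOn (fun x => (Real.Gamma a)⁻¹ * b⁻¹ * G (b⁻¹ * x))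
      (fun x => genGammaPDF a b c x * h x) (Set.Ioi 0) := by
    intro x (hx : 0 < x)
    have hx' : 0 < b⁻¹ * x := by positivity
    have h1 : b * ((b⁻¹ * x) ^ c) ^ (1 / c) = x := by
      rw [← Real.rpow_mul hx'.le, mul_one_div_cancel hc.ne', Real.rpow_one]
      field_simp
    have h2 : (b⁻¹ * x) ^ (c - 1) * ((b⁻¹ * x) ^ c) ^ (a - 1) =
        x ^ (a * c - 1) / b ^ (a * c) * b := by
      rw [← Real.rpow_mul hx'.le, ← Real.rpow_add hx',
        show c - 1 + c * (a - 1) = a * c - 1 by ring, Real.mul_rpow (by positivity) hx.le,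
        Real.inv_rpow hb.le, Real.rpow_sub_one hb.ne']
      field_simp
    simp only [hG, hF, h1, smul_eq_mul, genGammaPDF]
    rw [show x / b = b⁻¹ * x by ring]
    calc _ = (Real.Gamma a)⁻¹ * b⁻¹ * c * ((b⁻¹ * x) ^ (c - 1) * ((b⁻¹ * x) ^ c) ^ (a - 1)) *
        Real.exp (-(b⁻¹ * x) ^ c) * h x := by ring
      _ = _ := by
        rw [h2]
        field_simp
  have hGint : IntegrableOn G (Set.Ioi 0) := by
    have := (integrableOn_Ioi_comp_rpow_iff F hc.ne').2 hint
    simpa only [abs_of_pos hc] using this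
  constructor
  · refine IntegrableOn.congr_fun (Integrable.const_mul ?_ _) heq measurableSet_Ioi
    exact (integrableOn_Ioi_comp_mul_left_iff G 0 (inv_pos.2 hb)).2 (by simpa using hGint)
  · rw [← setIntegral_congr_fun measurableSet_Ioi heq, integral_const_mul,
      integral_comp_mul_left_Ioi G 0 (inv_pos.2 hb), mul_zero, integral_comp_rpow_Ioi_of_pos hc,
      genGammaMean, smul_eq_mul, inv_inv, mul_assoc, inv_mul_cancel_left₀ hb.ne']

theorem eggPDF_eq (p : EGGParams) : eggPDF p = (Set.Ioi 0).indicator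
    fun x => p.w * genGammaPDF 1 p.lam 1 x + (1 - p.w) * genGammaPDF p.a p.b p.c x := by
  ext x
  rw [Set.indicator_apply, eggPDF]
  simp only [Set.mem_Ioi]
  refine if_congr Iff.rfl ?_ rfl
  simp [genGammaPDF]
  ring

theorem measurable_eggPDF (p : EGGParams) : Measurable (eggPDF p) := by
  rw [eggPDF_eq]
  refine Measurable.indicator ?_ measurableSet_Ioi
  unfold genGammaPDF
  fun_prop

theorem genGammaPDF_nonneg {a b c x : ℝ} (ha : 0 < a) (hb : 0 < b) (hc : 0 < c) (hx : 0 < x) :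
    0 ≤ genGammaPDF a b c x := by
  have := Real.Gamma_pos_of_pos ha
  unfold genGammaPDF
  positivity

theorem eggPDF_nonneg (p : EGGParams) (x : ℝ) : 0 ≤ eggPDF p x := by
  rw [eggPDF_eq]
  refine Set.indicator_nonneg (fun x hx => ?_) x
  have h1 := genGammaPDF_nonneg one_pos p.lam_pos one_pos hx
  have h2 := genGammaPDF_nonneg p.a_pos p.b_pos p.c_pos hx
  have h3 := p.w_pos
  have h4 := sub_pos.2 p.w_lt_one
  positivity

theorem eggMeasure_absolutelyContinuous (p : EGGParams) : eggMeasure p ≪ volume :=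
  withDensity_absolutelyContinuous _ _

theorem ae_eggMeasure_pos (p : EGGParams) : ∀ᵐ x ∂eggMeasure p, 0 < x := by
  rw [eggMeasure, ae_withDensity_iff (measurable_eggPDF p).ennreal_ofReal]
  refine Filter.Eventually.of_forall fun x hx => ?_
  by_contra h
  exact hx (by simp [eggPDF, h])

/-- The unsimplified `(1 : ℝ) - 1` and `1 / (1 : ℝ)` keep the exponential component literally the
case `a = c = 1` of the generalized Gamma lemmas. -/
theorem integral_eggMeasure (p : EGGParams) {h : ℝ → ℝ}
    (h₁ : IntegrableOn (fun x => x ^ ((1 : ℝ) - 1) * Real.exp (-x) *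
      h (p.lam * x ^ (1 / (1 : ℝ)))) (Set.Ioi 0))
    (h₂ : IntegrableOn (fun x => x ^ (p.a - 1) * Real.exp (-x) *
      h (p.b * x ^ (1 / p.c))) (Set.Ioi 0)) :
    Integrable h (eggMeasure p) ∧ ∫ x, h x ∂eggMeasure p =
      p.w * genGammaMean 1 p.lam 1 h + (1 - p.w) * genGammaMean p.a p.b p.c h := by
  obtain ⟨i₁, e₁⟩ := integral_genGammaPDF_mul p.lam_pos one_pos h₁
  obtain ⟨i₂, e₂⟩ := integral_genGammaPDF_mul p.b_pos p.c_pos h₂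
  have hm := (measurable_eggPDF p).ennreal_ofReal
  have hlt : ∀ᵐ x : ℝ, ENNReal.ofReal (eggPDF p x) < ⊤ :=
    Filter.Eventually.of_forall fun x => ENNReal.ofReal_lt_top
  have heq : (fun x => (ENNReal.ofReal (eggPDF p x)).toReal • h x) = (Set.Ioi 0).indicator
      fun x => p.w * (genGammaPDF 1 p.lam 1 x * h x) +
        (1 - p.w) * (genGammaPDF p.a p.b p.c x * h x) := by
    ext x
    rw [ENNReal.toReal_ofReal (eggPDF_nonneg p x), eggPDF_eq, smul_eq_mul,
      ← Set.indicator_mul_left]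
    refine congrFun (congrArg _ ?_) x
    ext y
    ring
  have hi := (i₁.const_mul p.w).add (i₂.const_mul (1 - p.w))
  constructor
  · rw [eggMeasure, integrable_withDensity_iff_integrable_smul' hm hlt, heq,
      integrable_indicator_iff measurableSet_Ioi]
    exact hi
  · rw [eggMeasure, integral_withDensity_eq_integral_toReal_smul hm hlt, heq,
      integral_indicator measurableSet_Ioi, integral_add (i₁.const_mul _) (i₂.const_mul _),
      integral_const_mul, integral_const_mul, e₁, e₂]

theorem genGammaMean_const_mul_pow {a b c : ℝ} (ha : 0 < a) (hc : 0 < c) (k : ℝ)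
    (m : ℕ) :
    IntegrableOn (fun x => x ^ (a - 1) * Real.exp (-x) * (k * (b * x ^ (1 / c)) ^ m))
      (Set.Ioi 0) ∧
    genGammaMean a b c (fun x => k * x ^ m) =
      k * b ^ m * Real.Gamma (a + m / c) / Real.Gamma a := by
  have hs : 0 < a + m / c := by positivity
  have heq : Set.EqOn (fun x => k * b ^ m * (Real.exp (-x) * x ^ (a + m / c - 1)))
      (fun x => x ^ (a - 1) * Real.exp (-x) * (k * (b * x ^ (1 / c)) ^ m)) (Set.Ioi 0) := by
    intro x (hx : 0 < x)
    simp only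
    rw [mul_pow, ← Real.rpow_natCast (x ^ (1 / c)), ← Real.rpow_mul hx.le,
      show a + m / c - 1 = (a - 1) + 1 / c * m by ring, Real.rpow_add hx]
    ring
  constructor
  · exact IntegrableOn.congr_fun ((Real.GammaIntegral_convergent hs).const_mul _) heq
      measurableSet_Ioi
  · rw [genGammaMean, ← setIntegral_congr_fun measurableSet_Ioi heq, integral_const_mul,
      ← Real.Gamma_eq_integral hs]
    ring

theorem integral_eggMeasure_const_mul_pow (p : EGGParams) (k : ℝ) (m : ℕ) :
    Integrable (fun x => k * x ^ m) (eggMeasure p) ∧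
    ∫ x, k * x ^ m ∂eggMeasure p = k * (p.w * (p.lam ^ m * Real.Gamma (1 + m)) +
      (1 - p.w) * (p.b ^ m * Real.Gamma (p.a + m / p.c) / Real.Gamma p.a)) := by
  obtain ⟨i₁, e₁⟩ := genGammaMean_const_mul_pow (b := p.lam) one_pos one_pos k m
  obtain ⟨i₂, e₂⟩ := genGammaMean_const_mul_pow (b := p.b) p.a_pos p.c_pos k m
  obtain ⟨i, e⟩ := integral_eggMeasure p (h := fun x => k * x ^ m) i₁ i₂
  refine ⟨i, ?_⟩
  rw [e, e₁, e₂, Real.Gamma_one, div_one, div_one]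
  ring

/-- The gain is at most `1`, so the Gamma integrand dominates. With `q = μ (b x ^ (1 / c)) ^ r`, the
identity `q / (q + C) = (1 + C / q)⁻¹` brings the mean to the integral form of the H-function. -/
theorem genGammaMean_relayGain {a b c : ℝ} (ha : 0 < a) (hb : 0 < b) (hc : 0 < c)
    {μ C : ℝ} (hμ : 0 < μ) (hC : 0 < C) {r : ℕ} (hr : r ≠ 0) {n : ℕ} (hn : 1 ≤ n) :
    IntegrableOn (fun x => x ^ (a - 1) * Real.exp (-x) *
      (μ * (b * x ^ (1 / c)) ^ r / (μ * (b * x ^ (1 / c)) ^ r + C)) ^ n) (Set.Ioi 0) ∧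
    FoxHWellDefined 2 1 ![((1 - n : ℂ), (1 : ℝ))] ![((0 : ℂ), (1 : ℝ)), ((a : ℂ), (r / c : ℝ))]
      ((C / (b ^ r * μ) : ℝ) : ℂ) ∧
    foxH 2 1 ![((1 - n : ℂ), (1 : ℝ))] ![((0 : ℂ), (1 : ℝ)), ((a : ℂ), (r / c : ℝ))]
      ((C / (b ^ r * μ) : ℝ) : ℂ) =
      ((Real.Gamma n * Real.Gamma a *
        genGammaMean a b c (fun x => (μ * x ^ r / (μ * x ^ r + C)) ^ n) : ℝ) : ℂ) := by
  constructor
  · refine ((Real.GammaIntegral_convergent ha).mono' ?_ ?_)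
    · exact (by fun_prop : Measurable _).aestronglyMeasurable
    · filter_upwards [ae_restrict_mem measurableSet_Ioi] with x hx
      have hx : 0 < x := hx
      have hq : 0 ≤ μ * (b * x ^ (1 / c)) ^ r := by positivity
      rw [Real.norm_of_nonneg (by positivity), mul_comm (Real.exp (-x))]
      refine mul_le_of_le_one_right (by positivity) (pow_le_one₀ (by positivity) ?_)
      rw [div_le_one (by positivity)]
      linarith
  · have hr' : (0 : ℝ) < r := by exact_mod_cast Nat.pos_of_ne_zero hr
    obtain ⟨h1, h2⟩ := foxH_wellDefined_and_eq hn ha (div_pos hr' hc)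
      (by positivity : 0 < C / (b ^ r * μ))
    refine ⟨h1, h2.trans ?_⟩
    have hΓ := (Real.Gamma_pos_of_pos ha).ne'
    rw [genGammaMean, mul_assoc, mul_inv_cancel_left₀ hΓ]
    congr 2
    refine setIntegral_congr_fun measurableSet_Ioi fun x (hx : 0 < x) => ?_
    congr 1
    rw [Real.rpow_neg (by positivity), Real.rpow_natCast, ← inv_pow]
    congr 1
    have hx' : (x ^ (1 / c)) ^ r = x ^ (r / c) := by
      rw [← Real.rpow_natCast, ← Real.rpow_mul hx.le]
      congr 1
      ring
    rw [mul_pow, hx', Real.rpow_neg hx.le]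
    have : 0 < x ^ (r / c) := by positivity
    field_simp

/-! ### Average electrical SNR, and the density of the end-to-end SNR. -/

theorem hopSNR_eq (η N : ℝ) (r : ℕ) (x : ℝ) : hopSNR η N r x = electricalSNR η N r * x ^ r := by
  rw [hopSNR, electricalSNR, mul_pow]
  ring

theorem isAverageElectricalSNR_hop {Ω : Type*} [MeasurableSpace Ω] {P : Measure Ω} {I : Ω → ℝ}
    {p : EGGParams} (hI : HasLaw I (eggMeasure p) P) (μ : ℝ) (r : ℕ) :
    IsAverageElectricalSNR p r (∫ x, I x ∂P) (∫ x, μ * I x ^ r ∂P) μ := by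
  constructor
  · rintro rfl h
    simp only [pow_one, integral_const_mul, h, mul_one]
  · rintro rfl
    obtain ⟨i, e⟩ := integral_eggMeasure_const_mul_pow p μ 2
    have h := hI.integral_comp i.aestronglyMeasurable
    simp only [Function.comp_def] at h
    have hΓ := Real.Gamma_pos_of_pos p.a_pos
    have hΓ' : 0 < Real.Gamma (p.a + 2 / p.c) :=
      Real.Gamma_pos_of_pos (add_pos p.a_pos (div_pos two_pos p.c_pos))
    have hw := p.w_pos
    have hw' := sub_pos.2 p.w_lt_one
    have hl := p.lam_pos
    have hb := p.b_pos
    -- This is the source of the coefficient `2` in `2 ω λ²`.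
    have h3 : Real.Gamma (1 + 2) = 2 := by
      rw [show (1 + 2 : ℝ) = ((2 : ℕ) : ℝ) + 1 by norm_num, Real.Gamma_nat_eq_factorial]
      norm_num
    have hD : 0 < 2 * p.w * p.lam ^ 2 +
        p.b ^ 2 * (1 - p.w) * Real.Gamma (p.a + 2 / p.c) / Real.Gamma p.a := by positivity
    rw [h, e, eq_div_iff hD.ne']
    push_cast
    rw [h3]
    ring

/-- The set lies in the image of `N ∩ (0, ∞)` under the inverse map `y ↦ (y / c) ^ (1 / r)`. That
map is differentiable away from `0`, and differentiable maps send null sets to null sets. -/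
theorem volume_pos_and_const_mul_pow_mem {c : ℝ} (hc : 0 < c) {r : ℕ} (hr : r ≠ 0) {N : Set ℝ}
    (hN : volume N = 0) : volume {x : ℝ | 0 < x ∧ c * x ^ r ∈ N} = 0 := by
  have hsub : {x : ℝ | 0 < x ∧ c * x ^ r ∈ N} ⊆
      (fun y : ℝ => (y / c) ^ ((r : ℝ)⁻¹)) '' (N ∩ Set.Ioi 0) := by
    rintro x ⟨hx, hxN⟩
    refine ⟨c * x ^ r, ⟨hxN, by simp only [Set.mem_Ioi]; positivity⟩, ?_⟩
    simp only
    rw [mul_div_cancel_left₀ _ hc.ne', Real.pow_rpow_inv_natCast hx.le hr]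
  refine measure_mono_null hsub (addHaar_image_eq_zero_of_differentiableOn_of_addHaar_eq_zero _
    (fun y hy => ?_) (measure_mono_null Set.inter_subset_left hN))
  have hy' : y / c ≠ 0 := (div_pos hy.2 hc).ne'
  exact ((differentiableAt_id.div_const c).rpow_const (Or.inl hy')).differentiableWithinAt

/-- A density exists exactly when the law is absolutely continuous. Under the product law, a null
set has null preimage as soon as almost every slice `Y = y` is null, and almost every `y` is
positive. -/
theorem hasPDF_const_mul_pow_mul {Ω : Type*} [MeasurableSpace Ω] {P : Measure Ω}
    [IsProbabilityMeasure P] {X Y : Ω → ℝ} {p q : EGGParams} (hX : HasLaw X (eggMeasure p) P)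
    (hY : HasLaw Y (eggMeasure q) P) (hind : IndepFun X Y P) {r : ℕ} (hr : r ≠ 0)
    {g : ℝ → ℝ} (hg : Measurable g) (hpos : ∀ y, 0 < y → 0 < g y) :
    HasPDF (fun ω => g (Y ω) * X ω ^ r) P volume := by
  have hp : IsProbabilityMeasure (eggMeasure p) := hX.isProbabilityMeasure_iff.1 inferInstance
  have hq : IsProbabilityMeasure (eggMeasure q) := hY.isProbabilityMeasure_iff.1 inferInstance
  have hlaw := hind.symm.hasLaw_prod hY hX
  have hF : Measurable fun z : ℝ × ℝ => g z.1 * z.2 ^ r := by fun_prop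
  have hmeas : AEMeasurable (fun ω => g (Y ω) * X ω ^ r) P :=
    hF.comp_aemeasurable hlaw.aemeasurable
  rw [Real.hasPDF_iff_of_aemeasurable hmeas]
  refine Measure.AbsolutelyContinuous.mk fun N hN hN0 => ?_
  rw [Measure.map_apply_of_aemeasurable hmeas hN]
  have h := hlaw.measure_eq (p := fun z : ℝ × ℝ => g z.1 * z.2 ^ r ∈ N) (hF hN)
  refine h.trans ?_
  refine (Measure.measure_prod_null (hF hN)).2 ?_
  filter_upwards [ae_eggMeasure_pos q] with y hy
  have h1 : eggMeasure p {x : ℝ | 0 < x ∧ g y * x ^ r ∈ N} = 0 :=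
    eggMeasure_absolutelyContinuous p (volume_pos_and_const_mul_pow_mem (hpos y hy) hr hN0)
  have h2 : eggMeasure p {x : ℝ | ¬ 0 < x} = 0 := ae_iff.1 (ae_eggMeasure_pos p)
  refine measure_mono_null (fun x hx => ?_) (measure_union_null h1 h2)
  by_cases hx0 : 0 < x
  · exact Or.inl ⟨hx0, hx⟩
  · exact Or.inr hx0

theorem integral_pow_eq_setIntegral_pdf {Ω : Type*} [MeasurableSpace Ω] {P : Measure Ω}
    [IsProbabilityMeasure P] {X : Ω → ℝ} [HasPDF X P volume] (hpos : ∀ᵐ ω ∂P, 0 < X ω) (n : ℕ) :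
    ∫ ω, X ω ^ n ∂P = ∫ y in Set.Ioi (0 : ℝ), y ^ n * (pdf X P volume y).toReal := by
  -- Truncating the power to `(0, ∞)` restricts the density integral to the half-line and, as `X >
  -- 0` almost surely, leaves the mean unchanged.
  have hm : Measurable ((Set.Ioi (0 : ℝ)).indicator fun y => y ^ n) :=
    (by fun_prop : Measurable fun y : ℝ => y ^ n).indicator measurableSet_Ioi
  have h : ∫ y, (pdf X P volume y).toReal • (Set.Ioi (0 : ℝ)).indicator (fun y => y ^ n) y =
      ∫ ω, (Set.Ioi (0 : ℝ)).indicator (fun y => y ^ n) (X ω) ∂P :=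
    pdf.integral_pdf_smul hm.aestronglyMeasurable
  rw [← integral_indicator measurableSet_Ioi]
  refine Eq.trans ?_ (h.symm.trans (integral_congr_ae (Filter.Eventually.of_forall fun y => ?_)))
  · refine integral_congr_ae ?_
    filter_upwards [hpos] with ω hω
    rw [Set.indicator_of_mem (by exact hω)]
  · by_cases hy : y ∈ Set.Ioi (0 : ℝ)
    · simp [Set.indicator_of_mem hy, mul_comm]
    · simp [Set.indicator_of_notMem hy]

/-! ### The moment formula. -/

theorem theorem3 {Ω : Type*} [MeasurableSpace Ω] (P : Measure Ω) [IsProbabilityMeasure P]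
    (I₁ I₂ : Ω → ℝ) (p₁ p₂ : EGGParams)
    (hI₁ : HasLaw I₁ (eggMeasure p₁) P) (hI₂ : HasLaw I₂ (eggMeasure p₂) P)
    (hind : IndepFun I₁ I₂ P)
    (r₁ r₂ : ℕ) (hr₁ : r₁ = 1 ∨ r₁ = 2) (hr₂ : r₂ = 1 ∨ r₂ = 2)
    (η N₁ N₂ C : ℝ) (hη : 0 < η) (hN₁ : 0 < N₁) (hN₂ : 0 < N₂) (hC : 0 < C)
    (γ₁ γ₂ γ : Ω → ℝ)
    (hγ₁ : ∀ x, γ₁ x = hopSNR η N₁ r₁ (I₁ x)) (hγ₂ : ∀ x, γ₂ x = hopSNR η N₂ r₂ (I₂ x))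
    (hγ : ∀ x, γ x = endToEndSNR C (γ₁ x) (γ₂ x))
    (μ₁ μ₂ : ℝ) (hμ₁ : μ₁ = electricalSNR η N₁ r₁) (hμ₂ : μ₂ = electricalSNR η N₂ r₂)
    (n : ℕ) (hn : 1 ≤ n) :
    IsAverageElectricalSNR p₁ r₁ (∫ x, I₁ x ∂P) (∫ x, γ₁ x ∂P) μ₁ ∧
    IsAverageElectricalSNR p₂ r₂ (∫ x, I₂ x ∂P) (∫ x, γ₂ x ∂P) μ₂ ∧
    HasPDF γ P volume ∧
    Integrable (fun x => γ x ^ n) P ∧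
    ∫ x, γ x ^ n ∂P = ∫ y in Set.Ioi (0 : ℝ), y ^ n * (pdf γ P volume y).toReal ∧
    FoxHWellDefined 2 1 ![((1 - n : ℂ), (1 : ℝ))] ![((0 : ℂ), (1 : ℝ)), ((1 : ℂ), (r₂ : ℝ))]
      ((C / (p₂.lam ^ r₂ * μ₂) : ℝ) : ℂ) ∧
    FoxHWellDefined 2 1 ![((1 - n : ℂ), (1 : ℝ))]
      ![((0 : ℂ), (1 : ℝ)), ((p₂.a : ℂ), (r₂ / p₂.c : ℝ))]
      ((C / (p₂.b ^ r₂ * μ₂) : ℝ) : ℂ) ∧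
    ((∫ x, γ x ^ n ∂P : ℝ) : ℂ) =
      ((p₁.w * p₂.w / Real.Gamma n * Real.Gamma (1 + r₁ * n) * (p₁.lam ^ r₁ * μ₁) ^ n +
          p₂.w * (1 - p₁.w) * (p₁.b ^ r₁ * μ₁) ^ n / (Real.Gamma p₁.a * Real.Gamma n) *
            Real.Gamma (p₁.a + r₁ * n / p₁.c) : ℝ) : ℂ) *
        foxH 2 1 ![((1 - n : ℂ), (1 : ℝ))] ![((0 : ℂ), (1 : ℝ)), ((1 : ℂ), (r₂ : ℝ))]
          ((C / (p₂.lam ^ r₂ * μ₂) : ℝ) : ℂ) +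
      ((p₁.w * (1 - p₂.w) * Real.Gamma (1 + r₁ * n) * (p₁.lam ^ r₁ * μ₁) ^ n /
            (Real.Gamma p₂.a * Real.Gamma n) +
          (1 - p₁.w) * (1 - p₂.w) * (p₁.b ^ r₁ * μ₁) ^ n /
            (Real.Gamma p₁.a * Real.Gamma p₂.a * Real.Gamma n) *
            Real.Gamma (p₁.a + r₁ / p₁.c * n) : ℝ) : ℂ) *
        foxH 2 1 ![((1 - n : ℂ), (1 : ℝ))]
          ![((0 : ℂ), (1 : ℝ)), ((p₂.a : ℂ), (r₂ / p₂.c : ℝ))]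
          ((C / (p₂.b ^ r₂ * μ₂) : ℝ) : ℂ) := by
  have hr₁0 : r₁ ≠ 0 := by omega
  have hr₂0 : r₂ ≠ 0 := by omega
  have hμ₁pos : 0 < μ₁ := by rw [hμ₁, electricalSNR]; positivity
  have hμ₂pos : 0 < μ₂ := by rw [hμ₂, electricalSNR]; positivity
  obtain rfl : γ₁ = fun x => μ₁ * I₁ x ^ r₁ := funext fun x => by rw [hγ₁, hopSNR_eq, hμ₁]
  obtain rfl : γ₂ = fun x => μ₂ * I₂ x ^ r₂ := funext fun x => by rw [hγ₂, hopSNR_eq, hμ₂]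
  set g : ℝ → ℝ := fun y => μ₂ * y ^ r₂ / (μ₂ * y ^ r₂ + C) with hg
  have hgm : Measurable g := by fun_prop
  have hgpos : ∀ y, 0 < y → 0 < g y := fun y hy => by simp only [hg]; positivity
  obtain rfl : γ = fun x => g (I₂ x) * μ₁ * I₁ x ^ r₁ := funext fun x => by
    rw [hγ, endToEndSNR]
    simp only [hg]
    ring
  have hpdf : HasPDF (fun x => g (I₂ x) * μ₁ * I₁ x ^ r₁) P volume :=
    hasPDF_const_mul_pow_mul hI₁ hI₂ hind hr₁0 (g := fun y => g y * μ₁) (by fun_prop)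
      (fun y hy => mul_pos (hgpos y hy) hμ₁pos)
  have hpos : ∀ᵐ x ∂P, 0 < g (I₂ x) * μ₁ * I₁ x ^ r₁ := by
    have h₁ := (hI₁.ae_iff (p := fun x => 0 < x) (by fun_prop)).2 (ae_eggMeasure_pos p₁)
    have h₂ := (hI₂.ae_iff (p := fun x => 0 < x) (by fun_prop)).2 (ae_eggMeasure_pos p₂)
    filter_upwards [h₁, h₂] with x hx₁ hx₂
    have := hgpos _ hx₂
    positivity
  obtain ⟨i₁, e₁⟩ := integral_eggMeasure_const_mul_pow p₁ (μ₁ ^ n) (r₁ * n)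
  -- The exponential and generalized Gamma components of the second hop yield one H-function each.
  obtain ⟨j₁, w₁, f₁⟩ :=
    genGammaMean_relayGain one_pos p₂.lam_pos one_pos hμ₂pos hC hr₂0 hn
  obtain ⟨j₂, w₂, f₂⟩ :=
    genGammaMean_relayGain p₂.a_pos p₂.b_pos p₂.c_pos hμ₂pos hC hr₂0 hn
  obtain ⟨i₂, e₂⟩ := integral_eggMeasure p₂ (h := fun y => g y ^ n) j₁ j₂
  simp only [div_one, Complex.ofReal_one] at w₁ f₁
  have hpow : (fun x => (g (I₂ x) * μ₁ * I₁ x ^ r₁) ^ n) =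
      fun x => (μ₁ ^ n * I₁ x ^ (r₁ * n)) * g (I₂ x) ^ n := by
    ext x
    ring
  have hind' : IndepFun (fun x => μ₁ ^ n * I₁ x ^ (r₁ * n)) (fun x => g (I₂ x) ^ n) P :=
    hind.comp (φ := fun x => μ₁ ^ n * x ^ (r₁ * n)) (ψ := fun y => g y ^ n)
      (by fun_prop) (by fun_prop)
  have k₁ : Integrable (fun x => μ₁ ^ n * I₁ x ^ (r₁ * n)) P := by
    rw [← hI₁.map_eq] at i₁
    exact i₁.comp_aemeasurable hI₁.aemeasurable
  have k₂ : Integrable (fun x => g (I₂ x) ^ n) P := by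
    rw [← hI₂.map_eq] at i₂
    exact i₂.comp_aemeasurable hI₂.aemeasurable
  have E₁ := hI₁.integral_comp i₁.aestronglyMeasurable
  have E₂ := hI₂.integral_comp i₂.aestronglyMeasurable
  simp only [Function.comp_def] at E₁ E₂
  refine ⟨isAverageElectricalSNR_hop hI₁ μ₁ r₁, isAverageElectricalSNR_hop hI₂ μ₂ r₂, hpdf, ?_,
    integral_pow_eq_setIntegral_pdf hpos n, w₁, w₂, ?_⟩
  · rw [hpow]
    exact hind'.integrable_mul k₁ k₂
  -- Each H-value is `Γ(n) Γ(a)` times a mean gain, with `a = 1` or `a = p₂.a`; the prefactors of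
  -- the formula cancel these Gamma values.
  · have hΓn : Real.Gamma n ≠ 0 := (Real.Gamma_pos_of_pos (by exact_mod_cast hn)).ne'
    have hΓ₁ := (Real.Gamma_pos_of_pos p₁.a_pos).ne'
    have hΓ₂ := (Real.Gamma_pos_of_pos p₂.a_pos).ne'
    rw [hpow, hind'.integral_fun_mul_eq_mul_integral k₁.aestronglyMeasurable
      k₂.aestronglyMeasurable, E₁, E₂, e₁, e₂, f₁, f₂, ← Complex.ofReal_mul, ← Complex.ofReal_mul,
      ← Complex.ofReal_add, Real.Gamma_one, Nat.cast_mul, ← mul_div_right_comm, mul_pow, mul_pow,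
      ← pow_mul, ← pow_mul]
    congr 1
    field_simp
    rfl
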